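/- Let $a_1,a_2$ be the annihilation operators of two bosonic modes on $\ell^2(\mathbb C)^{\otimes 2}$, with vacuum $|0\rangle|0\rangle$, and for $g>0$, $\theta,\phi\in\mathbb R$ let $$H=\theta\,(a_1^\dagger a_1+a_2^\dagger a_2)+2g\sin\tfrac{\phi}{2}\left(ie^{-i\phi/2}a_1^\dagger a_2^\dagger+h.c.\right).$$ Put $\phi=\pi$ and $\lambda=2g$, so that $H=\theta(a_1^\dagger a_1+a_2^\dagger a_2)+\lambda(a_1^\dagger a_2^\dagger+a_1a_2)$. The unitaries $e^{-iH}$ and $e^{\zeta a_1^\dagger a_2^\dagger-\bar\zeta a_1a_2}$ ($\zeta\in\mathbb C$) are well defined: each is the value at time $1$ of the unique strongly continuous one-parameter unitary group whose generator extends the operator in the exponent from the finite linear combinations of number states. (i) If $\lambda>0$ and $\lambda^2>\theta^2$, then $e^{-iH}|0\rangle|0\rangle$ is, up to a global phase, a two-mode squeezed vacuum: with $$f=\tfrac12\cosh^{-1}\left(\frac{-\theta^2+\lambda^2\cosh 2\sqrt{\lambda^2-\theta^2}}{\lambda^2-\theta^2}\right),\qquad \xi=\pi+\cos^{-1}\left(\frac{\theta\sinh\sqrt{\lambda^2-\theta^2}}{\sqrt{-\theta^2+\lambda^2\cosh^2\sqrt{\lambda^2-\theta^2}}}\right)$$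 and $\zeta=fe^{i\xi}$ one has $$e^{-iH}|0\rangle|0\rangle=i\,e^{i(\theta+\xi)}\,e^{\zeta a_1^\dagger a_2^\dagger-\bar\zeta a_1a_2}|0\rangle|0\rangle .$$ (ii) For fixed $\theta\in\mathbb R$, as $\lambda\to\infty$, $$e^{-i\theta}e^{-iH}|0\rangle|0\rangle-e^{\sqrt{\lambda^2-\theta^2}\left(e^{i(\pi+\cos^{-1}(\theta/\lambda))}a_1^\dagger a_2^\dagger-h.c.\right)}|0\rangle|0\rangle\longrightarrow 0\quad\text{in }\ell^2(\mathbb C)^{\otimes 2}.$$ Here $\cos^{-1}$ is the principal value, in $[0,\pi]$ (thus in $[0,\pi/2]$ for $\theta\ge 0$), and $\cosh^{-1}\ge 0$. -/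

import Mathlib

open Filter Topology

noncomputable section

namespace TwoMode

/-- The Hilbert space of two bosonic modes: `ℓ²(ℂ) ⊗ ℓ²(ℂ)`, realized as `ℓ²(ℕ × ℕ)` through the
orthonormal basis of number states `|m⟩|n⟩`. -/
abbrev Fock : Type := lp (fun _ : ℕ × ℕ => ℂ) 2

/-- The finite linear combinations of the number states (the common dense domain of all polynomials
in the creation and annihilation operators), as finitely supported coefficient families. -/
abbrev Fin₀ : Type := (ℕ × ℕ) →₀ ℂ

/-- The number state `|m⟩|n⟩` as a vector of the Hilbert space. -/
def ket (p : ℕ × ℕ) : Fock := lp.single 2 p (1 : ℂ)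

/-- The vacuum `|0⟩|0⟩`. -/
def vac : Fock := ket (0, 0)

/-- The inclusion of the finite linear combinations of number states in the Hilbert space. -/
def incl : Fin₀ →ₗ[ℂ] Fock := Finsupp.linearCombination ℂ ket

/-- The annihilation operator `a₁`: `a₁ |m⟩|n⟩ = √m |m-1⟩|n⟩` (which is `0` for `m = 0`). -/
def a₁ : Module.End ℂ Fin₀ :=
  Finsupp.linearCombination ℂ fun p => Finsupp.single (p.1 - 1, p.2) ((√(p.1 : ℝ) : ℝ) : ℂ)

/-- The annihilation operator `a₂`: `a₂ |m⟩|n⟩ = √n |m⟩|n-1⟩` (which is `0` for `n = 0`). -/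
def a₂ : Module.End ℂ Fin₀ :=
  Finsupp.linearCombination ℂ fun p => Finsupp.single (p.1, p.2 - 1) ((√(p.2 : ℝ) : ℝ) : ℂ)

/-- The creation operator `a₁†`: `a₁† |m⟩|n⟩ = √(m+1) |m+1⟩|n⟩`. -/
def a₁dag : Module.End ℂ Fin₀ :=
  Finsupp.linearCombination ℂ fun p => Finsupp.single (p.1 + 1, p.2) ((√((p.1 : ℝ) + 1) : ℝ) : ℂ)

/-- The creation operator `a₂†`: `a₂† |m⟩|n⟩ = √(n+1) |m⟩|n+1⟩`. -/
def a₂dag : Module.End ℂ Fin₀ :=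
  Finsupp.linearCombination ℂ fun p => Finsupp.single (p.1, p.2 + 1) ((√((p.2 : ℝ) + 1) : ℝ) : ℂ)

/-- The Hamiltonian of the interferometer,
`θ (a₁†a₁ + a₂†a₂) + 2 g sin(φ/2) (i e^{-iφ/2} a₁†a₂† + h.c.)`,
on the finite linear combinations of number states. -/
def hamiltonian (g θ φ : ℝ) : Module.End ℂ Fin₀ :=
  (θ : ℂ) • (a₁dag * a₁ + a₂dag * a₂) +
    ((2 * g * Real.sin (φ / 2) : ℝ) : ℂ) •
      ((Complex.I * Complex.exp (-Complex.I * (φ / 2))) • (a₁dag * a₂dag) +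
        (starRingEnd ℂ (Complex.I * Complex.exp (-Complex.I * (φ / 2)))) • (a₁ * a₂))

/-- The generator `ζ a₁†a₂† - ζ̄ a₁a₂` of two-mode squeezing. -/
def squeezeGen (ζ : ℂ) : Module.End ℂ Fin₀ :=
  ζ • (a₁dag * a₂dag) - (starRingEnd ℂ ζ) • (a₁ * a₂)

/-- `U` is a strongly continuous one-parameter unitary group on the Hilbert space, the
infinitesimal generator of which extends the operator `A`, that is, `d/dt U(t) v = A v` at `t = 0`
for every finite linear combination `v` of number states. -/
structure IsUnitaryGroup (A : Module.End ℂ Fin₀) (U : ℝ → (Fock ≃ₗᵢ[ℂ] Fock)) : Prop where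
  map_zero : ∀ ψ, U 0 ψ = ψ
  map_add : ∀ s t ψ, U (s + t) ψ = U s (U t ψ)
  continuous : ∀ ψ, Continuous fun t => U t ψ
  hasDerivAt : ∀ v : Fin₀, HasDerivAt (fun t => U t (incl v)) (incl (A v)) 0

open Classical in
/-- The unitary operator `e^A`: the value at time `1` of the unique strongly continuous
one-parameter unitary group whose generator extends `A` (`0` if there is no such group, or more
than one). -/
def unitaryExp (A : Module.End ℂ Fin₀) : Fock →L[ℂ] Fock :=
  if h : ∃! U, IsUnitaryGroup A U then (h.choose 1 : Fock →L[ℂ] Fock) else 0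

/-- The output state `e^{-iH}|0⟩|0⟩` of the interferometer at `φ = π`, where `lam = 2 g`. -/
def outState (lam θ : ℝ) : Fock :=
  unitaryExp ((-Complex.I) • hamiltonian (lam / 2) θ Real.pi) vac

/-- The two-mode squeezed vacuum `e^{ζ a₁†a₂† - ζ̄ a₁a₂}|0⟩|0⟩`. -/
def squeezedVac (ζ : ℂ) : Fock := unitaryExp (squeezeGen ζ) vac

/-- The squeezing strength
`f = ½ arcosh((-θ² + λ² cosh(2√(λ²-θ²))) / (λ²-θ²))`. -/
def sqF (lam θ : ℝ) : ℝ :=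
  1 / 2 * Real.arcosh
    ((-θ ^ 2 + lam ^ 2 * Real.cosh (2 * √(lam ^ 2 - θ ^ 2))) / (lam ^ 2 - θ ^ 2))

/-- The squeezing angle
`ξ = π + arccos(θ sinh √(λ²-θ²) / √(-θ² + λ² cosh² √(λ²-θ²)))`. -/
def sqXi (lam θ : ℝ) : ℝ :=
  Real.pi + Real.arccos
    (θ * Real.sinh √(lam ^ 2 - θ ^ 2) / √(-θ ^ 2 + lam ^ 2 * Real.cosh √(lam ^ 2 - θ ^ 2) ^ 2))

end TwoMode

end

/-! Both exponents belong to one family of skew-symmetric operators, `quadGen θ w`. They change the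
number of quanta by at most 2, with matrix elements growing linearly in that number, so `Aᵏ` applied
to a number state has norm at most `k! Cᵏ` up to a constant: number states are analytic vectors with
a common radius. This yields a unitary group as the strong limit of exponentials of finite
truncations (`exists_isUnitaryGroup`), and uniqueness even among bounded weak solutions
(`IsWeakSolution.eq_zero`).

Any bounded weak solution starting at the vacuum is therefore its orbit. The ansatz `c(t) ∑ z(t)ⁿ
|n⟩|n⟩` turns the equation into a Riccati equation for `z` and a linear one for `c`. For `μ² = |w|²
- θ² > 0` they are solved with the denominator `D = μ cosh μt + iθ sinh μt`
(`unitaryExp_quadGen_vac`). At `θ = 0` the same formula gives the squeezed vacuum, with ratio `u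
tanh f` and amplitude `1 / cosh f`.

Part (i) matches these parameters: at time 1, `cosh f = |D| / μ`, `sinh f = λ sinh μ / μ` and
`exp(iξ) = -i D̄ / |D|`. In part (ii) both states are unit vectors, and their exact overlap bounds
their squared distance by `2θ² / (λ² - θ²)`. -/

namespace TwoMode

open Complex Finsupp

local notation "⟪" x ", " y "⟫" => inner ℂ x y

/-! ### Number states and adjointness of the ladder operators. -/

theorem incl_single (p : ℕ × ℕ) (c : ℂ) : incl (single p c) = c • ket p := by
  simp [incl]

theorem inner_ket_left (p : ℕ × ℕ) (x : Fock) : ⟪ket p, x⟫ = x p := by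
  simp [ket, lp.inner_single_left]

theorem inner_ket_ket (p q : ℕ × ℕ) : ⟪ket p, ket q⟫ = if p = q then 1 else 0 := by
  rw [inner_ket_left, ket, lp.single_apply]
  by_cases h : p = q
  · subst h; simp
  · simp [h]

theorem norm_ket (p : ℕ × ℕ) : ‖ket p‖ = 1 := by
  have : ‖ket p‖ ^ 2 = 1 := by
    rw [← @inner_self_eq_norm_sq ℂ, inner_ket_ket]; simp
  nlinarith [norm_nonneg (ket p)]

theorem eq_zero_of_inner_ket {x : Fock} (h : ∀ p, ⟪ket p, x⟫ = 0) : x = 0 := by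
  ext p
  simpa [inner_ket_left] using h p

/-- An identity between sesquilinear expressions on the number states extends to finite linear
combinations. -/
theorem inner_adjoint_of_single {B C : Module.End ℂ Fin₀}
    (h : ∀ p q, ⟪ket p, incl (B (single q 1))⟫ = ⟪incl (C (single p 1)), ket q⟫) (u v : Fin₀) :
    ⟪incl u, incl (B v)⟫ = ⟪incl (C u), incl v⟫ := by
  induction u using Finsupp.induction_linear with
  | zero => simp
  | add f g hf hg => simp [hf, hg]
  | single p c =>
    induction v using Finsupp.induction_linear with
    | zero => simp
    | add f g hf hg => simp [hf, hg]
    | single q d =>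
      have hp : single p c = c • single p (1 : ℂ) := by simp
      have hq : single q d = d • single q (1 : ℂ) := by simp
      rw [hp, hq]
      simp only [map_smul, inner_smul_left, inner_smul_right, incl_single, one_smul, h]

theorem inner_a₁ (u v : Fin₀) : ⟪incl u, incl (a₁ v)⟫ = ⟪incl (a₁dag u), incl v⟫ := by
  refine inner_adjoint_of_single (fun p q => ?_) u v
  obtain ⟨m, n⟩ := p
  obtain ⟨k, l⟩ := q
  -- For `k = 0` the truncated index `k - 1` is harmless, because its coefficient is `√0 = 0`.
  cases k <;>
    simp +contextual [a₁, a₁dag, incl_single, inner_ket_ket]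

theorem inner_a₂ (u v : Fin₀) : ⟪incl u, incl (a₂ v)⟫ = ⟪incl (a₂dag u), incl v⟫ := by
  refine inner_adjoint_of_single (fun p q => ?_) u v
  obtain ⟨m, n⟩ := p
  obtain ⟨k, l⟩ := q
  cases l <;>
    simp +contextual [a₂, a₂dag, incl_single, inner_ket_ket]

theorem inner_a₁dag (u v : Fin₀) : ⟪incl u, incl (a₁dag v)⟫ = ⟪incl (a₁ u), incl v⟫ := by
  rw [← inner_conj_symm, ← inner_a₁, inner_conj_symm]

theorem inner_a₂dag (u v : Fin₀) : ⟪incl u, incl (a₂dag v)⟫ = ⟪incl (a₂ u), incl v⟫ := by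
  rw [← inner_conj_symm, ← inner_a₂, inner_conj_symm]

theorem a₁_single (p : ℕ × ℕ) (c : ℂ) :
    a₁ (single p c) = single (p.1 - 1, p.2) (c * (√(p.1 : ℝ) : ℝ)) := by
  simp only [a₁, linearCombination_single, smul_single, smul_eq_mul]

theorem a₂_single (p : ℕ × ℕ) (c : ℂ) :
    a₂ (single p c) = single (p.1, p.2 - 1) (c * (√(p.2 : ℝ) : ℝ)) := by
  simp only [a₂, linearCombination_single, smul_single, smul_eq_mul]

theorem a₁dag_single (p : ℕ × ℕ) (c : ℂ) :
    a₁dag (single p c) = single (p.1 + 1, p.2) (c * (√((p.1 : ℝ) + 1) : ℝ)) := by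
  simp only [a₁dag, linearCombination_single, smul_single, smul_eq_mul]

theorem a₂dag_single (p : ℕ × ℕ) (c : ℂ) :
    a₂dag (single p c) = single (p.1, p.2 + 1) (c * (√((p.2 : ℝ) + 1) : ℝ)) := by
  simp only [a₂dag, linearCombination_single, smul_single, smul_eq_mul]

theorem a₁dag_comm_a₂dag (v : Fin₀) : a₁dag (a₂dag v) = a₂dag (a₁dag v) := by
  induction v using Finsupp.induction_linear with
  | zero => simp
  | add f g hf hg => simp [hf, hg]
  | single p c => simp only [a₁dag_single, a₂dag_single, mul_right_comm]

theorem a₁_comm_a₂ (v : Fin₀) : a₁ (a₂ v) = a₂ (a₁ v) := by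
  induction v using Finsupp.induction_linear with
  | zero => simp
  | add f g hf hg => simp [hf, hg]
  | single p c => simp only [a₁_single, a₂_single, mul_right_comm]

/-! ### The common family of quadratic generators. -/

/-- The skew-symmetric operator `-i (θ (a₁†a₁ + a₂†a₂) + w a₁†a₂† + w̄ a₁a₂)`. -/
noncomputable def quadGen (θ : ℝ) (w : ℂ) : Module.End ℂ Fin₀ :=
  (-I) • ((θ : ℂ) • (a₁dag * a₁ + a₂dag * a₂) + w • (a₁dag * a₂dag) +
    (starRingEnd ℂ w) • (a₁ * a₂))

/-- The number terms are symmetric and the two pair terms are mutually adjoint, up to reversing the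
order of commuting factors; the factor `-i` turns symmetry into skew-symmetry. -/
theorem quadGen_skew (θ : ℝ) (w : ℂ) (u v : Fin₀) :
    ⟪incl u, incl (quadGen θ w v)⟫ = -⟪incl (quadGen θ w u), incl v⟫ := by
  simp only [quadGen, LinearMap.smul_apply, LinearMap.add_apply, Module.End.mul_apply, map_smul,
    map_add, inner_smul_left, inner_smul_right, inner_add_left, inner_add_right, inner_a₁,
    inner_a₂, inner_a₁dag, inner_a₂dag, a₁_comm_a₂ u, a₁dag_comm_a₂dag u]
  simp
  ring

theorem quadGen_single (θ : ℝ) (w : ℂ) (m n : ℕ) :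
    quadGen θ w (single (m, n) 1) =
      (-I * (θ * (m + n))) • single (m, n) 1 +
      (-I * (w * (√((m : ℝ) + 1) * √((n : ℝ) + 1) : ℝ))) • single (m + 1, n + 1) 1 +
      (-I * (starRingEnd ℂ w * (√(m : ℝ) * √(n : ℝ) : ℝ))) • single (m - 1, n - 1) 1 := by
  have key : ∀ k : ℕ, ((√(k : ℝ) : ℝ) : ℂ) * ((√(k : ℝ) : ℝ) : ℂ) = k := fun k => by
    rw [← ofReal_mul, Real.mul_self_sqrt (Nat.cast_nonneg k)]; simp
  have h1 : (a₁dag * a₁) (single (m, n) 1) = (m : ℂ) • single (m, n) 1 := by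
    cases m with
    | zero => simp [a₁_single]
    | succ k =>
      have := key (k + 1)
      push_cast at this
      simp [a₁_single, a₁dag_single, this, -single_add]
  have h2 : (a₂dag * a₂) (single (m, n) 1) = (n : ℂ) • single (m, n) 1 := by
    cases n with
    | zero => simp [a₂_single]
    | succ k =>
      have := key (k + 1)
      push_cast at this
      simp [a₂_single, a₂dag_single, this, -single_add]
  have h3 : (a₁dag * a₂dag) (single (m, n) 1) =
      ((√((m : ℝ) + 1) * √((n : ℝ) + 1) : ℝ) : ℂ) • single (m + 1, n + 1) 1 := by
    simp [a₁dag_single, a₂dag_single, mul_comm, -single_mul]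
  have h4 : (a₁ * a₂) (single (m, n) 1) =
      ((√(m : ℝ) * √(n : ℝ) : ℝ) : ℂ) • single (m - 1, n - 1) 1 := by
    simp [a₁_single, a₂_single, mul_comm, -single_mul]
  simp only [quadGen, LinearMap.smul_apply, LinearMap.add_apply, h1, h2, h3, h4]
  module

theorem squeezeGen_eq (ζ : ℂ) : squeezeGen ζ = quadGen 0 (I * ζ) := by
  refine LinearMap.ext fun v => ?_
  have h1 : -I * (I * ζ) = ζ := by rw [← mul_assoc, neg_mul, I_mul_I]; simp
  have h2 : -I * (-I * starRingEnd ℂ ζ) = -starRingEnd ℂ ζ := by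
    rw [← mul_assoc, neg_mul_neg, I_mul_I]; simp
  simp only [squeezeGen, quadGen, ofReal_zero, zero_smul, zero_add, smul_add, smul_smul, map_mul,
    conj_I, h1, h2, LinearMap.sub_apply, LinearMap.add_apply, LinearMap.smul_apply, neg_smul,
    sub_eq_add_neg]

theorem hamiltonian_eq (lam θ : ℝ) :
    (-I) • hamiltonian (lam / 2) θ Real.pi = quadGen θ lam := by
  have h : I * exp (-I * (Real.pi / 2)) = 1 := by
    rw [show -I * (Real.pi / 2 : ℂ) = -Real.pi / 2 * I by ring, exp_neg_pi_div_two_mul_I]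
    simp
  have h2 : 2 * (lam / 2) * Real.sin (Real.pi / 2) = lam := by simp; ring
  simp only [hamiltonian, quadGen, h, h2]
  simp [add_assoc]

/-! ### Linear growth and analytic vectors. -/

/-- The operator `A` raises the total number of quanta by at most `2` and its matrix elements grow
at most linearly with that number. -/
def LinearGrowth (A : Module.End ℂ Fin₀) (M : ℝ) : Prop :=
  ∀ (T : Fin₀ →ₗ[ℂ] Fock) (K : ℝ) (p : ℕ × ℕ),
    (∀ q : ℕ × ℕ, q.1 + q.2 ≤ p.1 + p.2 + 2 → ‖T (single q 1)‖ ≤ K) →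
      ‖T (A (single p 1))‖ ≤ M * ((p.1 + p.2 + 2 : ℕ) : ℝ) * K

theorem sqrt_mul_sqrt_le {x y : ℝ} (hx : 0 ≤ x) (hy : 0 ≤ y) : √x * √y ≤ (x + y) / 2 := by
  nlinarith [sq_nonneg (√x - √y), Real.sq_sqrt hx, Real.sq_sqrt hy]

theorem quadGen_linearGrowth (θ : ℝ) (w : ℂ) : LinearGrowth (quadGen θ w) (|θ| + ‖w‖) := by
  rintro T K ⟨m, n⟩ h
  have hK : 0 ≤ K := (norm_nonneg _).trans (h (m, n) (by simp))
  rw [quadGen_single, map_add, map_add, map_smul, map_smul, map_smul]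
  have e1 := h (m, n) (by simp)
  have e2 := h (m + 1, n + 1) (by simp; omega)
  have e3 := h (m - 1, n - 1) (by simp; omega)
  have s2 := sqrt_mul_sqrt_le (x := m + 1) (y := n + 1) (by positivity) (by positivity)
  have s3 := sqrt_mul_sqrt_le (x := m) (y := n) (by positivity) (by positivity)
  have c1 : ‖-I * (θ * (m + n) : ℂ)‖ = |θ| * (m + n) := by
    rw [norm_mul, norm_neg, norm_I, one_mul, norm_mul, norm_real, Real.norm_eq_abs,
      ← Nat.cast_add, norm_natCast, Nat.cast_add]
  have c2 : ‖-I * (w * (√((m : ℝ) + 1) * √((n : ℝ) + 1) : ℝ))‖ =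
      ‖w‖ * (√((m : ℝ) + 1) * √((n : ℝ) + 1)) := by
    rw [norm_mul, norm_neg, norm_I, one_mul, norm_mul, norm_real, Real.norm_of_nonneg]
    positivity
  have c3 : ‖-I * (starRingEnd ℂ w * (√(m : ℝ) * √(n : ℝ) : ℝ))‖ =
      ‖w‖ * (√(m : ℝ) * √(n : ℝ)) := by
    rw [norm_mul, norm_neg, norm_I, one_mul, norm_mul, RCLike.norm_conj, norm_real,
      Real.norm_of_nonneg]
    positivity
  calc _ ≤ |θ| * (m + n) * K + ‖w‖ * (((m : ℝ) + 1 + (n + 1)) / 2) * K +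
        ‖w‖ * (((m : ℝ) + n) / 2) * K := by
        refine (norm_add₃_le).trans ?_
        rw [norm_smul, norm_smul, norm_smul, c1, c2, c3]
        gcongr
    _ ≤ _ := by
        push_cast
        have := mul_nonneg (abs_nonneg θ) hK
        have := mul_nonneg (norm_nonneg w) hK
        nlinarith

/-- Each application of `A` costs `M` times the current number of quanta plus 2, and that number
rises by at most 2. The abstract sequence `T` covers both the powers of `A` and those of its
truncations, the latter uniformly in the truncation. -/
theorem norm_le_prod_of_linearGrowth {A : Module.End ℂ Fin₀} {M : ℝ} (hM : 0 ≤ M)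
    (hA : LinearGrowth A M) {T : ℕ → Fin₀ →ₗ[ℂ] Fock} (h0 : ∀ p, ‖T 0 (single p 1)‖ ≤ 1)
    (hT : ∀ k p, ‖T (k + 1) (single p 1)‖ ≤ ‖T k (A (single p 1))‖) (k : ℕ) (p : ℕ × ℕ) :
    ‖T k (single p 1)‖ ≤
      M ^ k * ((∏ j ∈ Finset.range k, (p.1 + p.2 + 2 * j + 2) : ℕ) : ℝ) := by
  induction k generalizing p with
  | zero => simpa using h0 p
  | succ k ih =>
    refine (hT k p).trans ((hA (T k) (M ^ k *
      ((∏ j ∈ Finset.range k, (p.1 + p.2 + 2 * (j + 1) + 2) : ℕ) : ℝ)) p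
        fun q hq => (ih q).trans ?_).trans_eq ?_)
    · refine mul_le_mul_of_nonneg_left (Nat.cast_le.2 ?_) (by positivity)
      exact Finset.prod_le_prod' fun j _ => by omega
    · rw [Finset.prod_range_succ']
      push_cast
      ring

theorem prod_add_two_mul_le (L k : ℕ) :
    ∏ j ∈ Finset.range k, (L + 2 * j + 2) ≤ k.factorial * 2 ^ L * 4 ^ k := by
  -- Factor by factor, `L + 2j + 2 ≤ 2(L + 1 + j)`; the rising factorial is then `k!` times a
  -- binomial coefficient.
  have h1 : ∏ j ∈ Finset.range k, (L + 2 * j + 2) ≤ 2 ^ k * (L + 1).ascFactorial k := by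
    rw [Nat.ascFactorial_eq_prod_range]
    calc _ ≤ ∏ j ∈ Finset.range k, (2 * (L + 1 + j)) :=
          Finset.prod_le_prod' fun j _ => by omega
      _ = _ := by rw [Finset.prod_mul_distrib]; simp
  have h2 : (L + k).choose k ≤ 2 ^ (L + k) := Nat.choose_le_two_pow _ _
  calc _ ≤ 2 ^ k * (k.factorial * 2 ^ (L + k)) := by
        refine h1.trans ?_
        rw [Nat.ascFactorial_eq_factorial_mul_choose]
        gcongr
    _ = _ := by rw [pow_add, show 4 = 2 * 2 by rfl, mul_pow]; ring

/-- Under linear growth, the powers of the operator grow at most like `k! Cᵏ`: number states are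
analytic vectors, with a radius of convergence that does not depend on the state. -/
theorem norm_le_factorial_of_linearGrowth {A : Module.End ℂ Fin₀} {M : ℝ} (hM : 0 ≤ M)
    (hA : LinearGrowth A M) {T : ℕ → Fin₀ →ₗ[ℂ] Fock} (h0 : ∀ p, ‖T 0 (single p 1)‖ ≤ 1)
    (hT : ∀ k p, ‖T (k + 1) (single p 1)‖ ≤ ‖T k (A (single p 1))‖) (k : ℕ) (p : ℕ × ℕ) :
    ‖T k (single p 1)‖ ≤ k.factorial * 2 ^ (p.1 + p.2) * (4 * M) ^ k := by
  refine (norm_le_prod_of_linearGrowth hM hA h0 hT k p).trans ?_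
  have : ((∏ j ∈ Finset.range k, (p.1 + p.2 + 2 * j + 2) : ℕ) : ℝ) ≤
      ((k.factorial * 2 ^ (p.1 + p.2) * 4 ^ k : ℕ) : ℝ) :=
    Nat.cast_le.2 (prod_add_two_mul_le (p.1 + p.2) k)
  calc _ ≤ M ^ k * ((k.factorial * 2 ^ (p.1 + p.2) * 4 ^ k : ℕ) : ℝ) := by gcongr
    _ = _ := by push_cast; ring

theorem norm_incl_pow_le {A : Module.End ℂ Fin₀} {M : ℝ} (hM : 0 ≤ M) (hA : LinearGrowth A M)
    (k : ℕ) (p : ℕ × ℕ) :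
    ‖incl ((A ^ k) (single p 1))‖ ≤ k.factorial * 2 ^ (p.1 + p.2) * (4 * M) ^ k :=
  norm_le_factorial_of_linearGrowth (T := fun k => incl ∘ₗ (A ^ k)) hM hA
    (fun p => by simp [incl_single, norm_ket]) (fun k p => by simp [pow_succ]) k p

/-! ### Uniqueness of bounded weak solutions. -/

/-- Taylor's estimate for a chain of functions each of which is, up to sign, the derivative of the
preceding one, all vanishing at the left end point. -/
theorem norm_le_of_deriv_chain {h : ℕ → ℝ → ℂ} {b : ℕ → ℝ} {s : ℝ}
    (hd : ∀ k t, HasDerivAt (h k) (-h (k + 1) t) t) (hs : ∀ k, h k s = 0)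
    (hb : ∀ k t, s ≤ t → ‖h k t‖ ≤ b k) (n k : ℕ) {t : ℝ} (ht : s ≤ t) :
    ‖h k t‖ ≤ b (k + n) * ((t - s) ^ n / n.factorial) := by
  induction n generalizing k t with
  | zero => simpa using hb k t ht
  | succ n ih =>
    refine image_norm_le_of_norm_deriv_right_le_deriv_boundary (a := s) (b := t)
      (f' := fun x => -h (k + 1) x)
      (B := fun t => b (k + (n + 1)) * ((t - s) ^ (n + 1) / (n + 1).factorial))
      (B' := fun t => b (k + (n + 1)) * ((t - s) ^ n / n.factorial))
      (fun x _ => (hd k x).continuousAt.continuousWithinAt)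
      (fun x _ => (hd k x).hasDerivWithinAt) (by simp [hs]) (fun x => ?_) (fun x hx => ?_)
      ⟨ht, le_rfl⟩
    · have := (((hasDerivAt_id x).sub_const s).pow (n + 1)).div_const ((n + 1).factorial : ℝ)
      refine (this.const_mul (b (k + (n + 1)))).congr_deriv ?_
      have h1 : ((n : ℝ) + 1) ≠ 0 := by positivity
      have h2 : (n.factorial : ℝ) ≠ 0 := by positivity
      rw [Nat.factorial_succ]
      push_cast
      simp only [id]
      field_simp
    · rw [norm_neg, show k + (n + 1) = k + 1 + n by ring]
      exact ih (k + 1) hx.1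

/-- `y` is a weak solution of `y' = A y`, for a skew-symmetric `A`. -/
def IsWeakSolution (A : Module.End ℂ Fin₀) (y : ℝ → Fock) : Prop :=
  ∀ (v : Fin₀) (t : ℝ), HasDerivAt (fun t => ⟪incl v, y t⟫) (-⟪incl (A v), y t⟫) t

theorem IsWeakSolution.sub {A : Module.End ℂ Fin₀} {y z : ℝ → Fock} (hy : IsWeakSolution A y)
    (hz : IsWeakSolution A z) : IsWeakSolution A fun t => y t - z t := fun v t => by
  simp only [inner_sub_right]
  exact ((hy v t).sub (hz v t)).congr_deriv (by ring)

theorem IsWeakSolution.eq_zero_of_le {A : Module.End ℂ Fin₀} {M : ℝ} (hM : 0 ≤ M)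
    (hA : LinearGrowth A M) {y : ℝ → Fock} (hy : IsWeakSolution A y) {K : ℝ}
    (hK : ∀ t, ‖y t‖ ≤ K) {s t : ℝ} (hs : y s = 0) (hst : s ≤ t)
    (ht : t ≤ s + 1 / (8 * M + 1)) : y t = 0 := by
  refine eq_zero_of_inner_ket fun p => ?_
  have hK0 : 0 ≤ K := (norm_nonneg _).trans (hK 0)
  -- The step `1 / (8M + 1)` makes the Taylor remainders decay like `2⁻ⁿ`; the added 1 covers `M =
  -- 0`.
  have hq : 4 * M * (t - s) ≤ 1 / 2 := by
    have h1 : t - s ≤ 1 / (8 * M + 1) := by linarith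
    have h2 : 4 * M * (1 / (8 * M + 1)) ≤ 1 / 2 := by
      rw [mul_one_div, div_le_div_iff₀ (by positivity) (by positivity)]
      linarith
    exact (mul_le_mul_of_nonneg_left h1 (by positivity)).trans h2
  have key : ∀ n : ℕ, ‖⟪ket p, y t⟫‖ ≤ 2 ^ (p.1 + p.2) * K * (1 / 2) ^ n := fun n => by
    -- Every derivative of the coefficient of `y` at `p` is, up to sign, a pairing of `y` with
    -- `Aᵏ|p⟩`, and all of them vanish at `s`.
    have := norm_le_of_deriv_chain (s := s) (h := fun k t => ⟪incl ((A ^ k) (single p 1)), y t⟫)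
      (b := fun k => (k.factorial * 2 ^ (p.1 + p.2) * (4 * M) ^ k) * K)
      (fun k t => by
        have := hy ((A ^ k) (single p 1)) t
        rwa [← Module.End.mul_apply, ← pow_succ'] at this)
      (fun k => by simp [hs])
      (fun k t _ => (norm_inner_le_norm _ _).trans
        (mul_le_mul (norm_incl_pow_le hM hA k p) (hK t) (norm_nonneg _) (by positivity)))
      n 0 hst
    simp only [pow_zero, Module.End.one_apply, incl_single, one_smul, zero_add] at this
    refine this.trans ?_
    have hf : (n.factorial : ℝ) ≠ 0 := by positivity
    calc _ = 2 ^ (p.1 + p.2) * K * (4 * M * (t - s)) ^ n := by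
          rw [mul_pow (4 * M)]; field_simp
      _ ≤ _ := by
          have : 0 ≤ 4 * M * (t - s) := mul_nonneg (by positivity) (by linarith)
          gcongr
  have lim : Tendsto (fun n : ℕ => 2 ^ (p.1 + p.2) * K * (1 / 2 : ℝ) ^ n) atTop (𝓝 0) := by
    simpa using (tendsto_pow_atTop_nhds_zero_of_lt_one (r := (1 / 2 : ℝ)) (by norm_num)
      (by norm_num)).const_mul (2 ^ (p.1 + p.2) * K)
  exact norm_le_zero_iff.1 (ge_of_tendsto' lim key)

/-- A bounded weak solution is determined for positive times by its initial value. -/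
theorem IsWeakSolution.eq_zero {A : Module.End ℂ Fin₀} {M : ℝ} (hM : 0 ≤ M)
    (hA : LinearGrowth A M) {y : ℝ → Fock} (hy : IsWeakSolution A y) {K : ℝ}
    (hK : ∀ t, ‖y t‖ ≤ K) (h0 : y 0 = 0) {t : ℝ} (ht : 0 ≤ t) : y t = 0 := by
  set r := 1 / (8 * M + 1) with hr
  have hr0 : 0 < r := by positivity
  -- The step length `r` is the same at every starting time, so finitely many steps reach any `t`.
  have key : ∀ n : ℕ, ∀ t, 0 ≤ t → t ≤ n * r → y t = 0 := fun n => by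
    induction n with
    | zero =>
      intro t h1 h2
      rw [le_antisymm (by simpa using h2) h1, h0]
    | succ n ih =>
      intro t h1 h2
      rcases le_total t (n * r) with h | h
      · exact ih t h1 h
      · exact hy.eq_zero_of_le hM hA hK (ih (n * r) (by positivity) le_rfl) h
          (by push_cast at h2; linarith)
  obtain ⟨n, hn⟩ := exists_nat_ge (t / r)
  exact key n t ht ((div_le_iff₀ hr0).1 hn)

/-- A group differentiable at time `0` on a vector is differentiable at all times. -/
theorem hasDerivAt_group {U : ℝ → (Fock ≃ₗᵢ[ℂ] Fock)}
    (hU : ∀ s t ψ, U (s + t) ψ = U s (U t ψ)) {x x' : Fock}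
    (hx : HasDerivAt (fun t => U t x) x' 0) (s : ℝ) :
    HasDerivAt (fun t => U t x) (U s x') s := by
  have h1 : HasDerivAt (fun t => U (t - s) x) x' s := by
    rw [← sub_self s] at hx
    exact hx.comp_sub_const s s
  have h2 := ((U s : Fock →L[ℂ] Fock).restrictScalars ℝ).hasFDerivAt.comp_hasDerivAt s h1
  refine h2.congr_of_eventuallyEq (Eventually.of_forall fun t => ?_)
  simp [← hU]

theorem IsUnitaryGroup.inner_neg {A : Module.End ℂ Fin₀} {U : ℝ → (Fock ≃ₗᵢ[ℂ] Fock)}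
    (hU : IsUnitaryGroup A U) (t : ℝ) (x y : Fock) : ⟪U (-t) x, y⟫ = ⟪x, U t y⟫ := by
  rw [← (U t).inner_map_map, ← hU.map_add, add_neg_cancel, hU.map_zero]

/-- The orbit of a general `x` need not be differentiable. By unitarity the group moves, with time
reversed, onto the test vector `v`, where its derivative is known. -/
theorem IsUnitaryGroup.isWeakSolution {A : Module.End ℂ Fin₀} {U : ℝ → (Fock ≃ₗᵢ[ℂ] Fock)}
    (hU : IsUnitaryGroup A U) (x : Fock) : IsWeakSolution A fun t => U t x := fun v t => by
  have h1 := (hasDerivAt_group hU.map_add (hU.hasDerivAt v) (-t)).scomp t (hasDerivAt_neg t)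
  have h2 := h1.inner ℂ (hasDerivAt_const t x)
  simp only [Function.comp_apply] at h2
  simp only [← hU.inner_neg]
  refine h2.congr_deriv ?_
  simp

theorem IsUnitaryGroup.eq_of_isWeakSolution {A : Module.End ℂ Fin₀} {M : ℝ} (hM : 0 ≤ M)
    (hA : LinearGrowth A M) {U : ℝ → (Fock ≃ₗᵢ[ℂ] Fock)} (hU : IsUnitaryGroup A U)
    {y : ℝ → Fock} (hy : IsWeakSolution A y) {K : ℝ} (hK : ∀ t, ‖y t‖ ≤ K) {t : ℝ} (ht : 0 ≤ t) :
    U t (y 0) = y t := by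
  refine sub_eq_zero.1 (((hU.isWeakSolution (y 0)).sub hy).eq_zero (K := ‖y 0‖ + K) hM hA
    (fun t => ?_) (by simp [hU.map_zero]) ht)
  refine (norm_sub_le _ _).trans ?_
  rw [LinearIsometryEquiv.norm_map]
  linarith [hK t]

theorem IsUnitaryGroup.unique {A : Module.End ℂ Fin₀} {M : ℝ} (hM : 0 ≤ M)
    (hA : LinearGrowth A M) {U V : ℝ → (Fock ≃ₗᵢ[ℂ] Fock)} (hU : IsUnitaryGroup A U)
    (hV : IsUnitaryGroup A V) : U = V := by
  have pos : ∀ t, 0 ≤ t → ∀ x, U t x = V t x := fun t ht x => by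
    have := hU.eq_of_isWeakSolution hM hA (hV.isWeakSolution x) (K := ‖x‖) (fun t => by simp) ht
    rwa [hV.map_zero] at this
  funext t
  ext1 x
  rcases le_total 0 t with h | h
  · exact pos t h x
  · apply (V (-t)).injective
    rw [← pos (-t) (by linarith), ← hU.map_add, ← hV.map_add]
    simp [hU.map_zero, hV.map_zero]

/-! ### Existence of the unitary group by finite truncation. -/

theorem exists_incl_norm_sub_lt (x : Fock) {ε : ℝ} (hε : 0 < ε) : ∃ v : Fin₀, ‖x - incl v‖ < ε := by
  have h := (lp.hasSum_single (p := 2) (by simp) x).eventually (Metric.ball_mem_nhds x hε)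
  obtain ⟨s, hs⟩ := h.exists
  refine ⟨∑ p ∈ s, single p (x p), ?_⟩
  have h2 : incl (∑ p ∈ s, single p (x p)) = ∑ p ∈ s, lp.single 2 p (x p) := by
    rw [map_sum]
    refine Finset.sum_congr rfl fun p _ => ?_
    rw [incl_single, ket, ← lp.single_smul, smul_eq_mul, mul_one]
  rw [h2, ← dist_eq_norm, dist_comm]
  exact hs

/-- A net of linear isometries converges pointwise as soon as it does on the number states. -/
theorem exists_tendsto_of_ket {F : Finset (ℕ × ℕ) → Fock →L[ℂ] Fock}
    (hF : ∀ S x, ‖F S x‖ = ‖x‖) (hk : ∀ p, ∃ y, Tendsto (fun S => F S (ket p)) atTop (𝓝 y))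
    (x : Fock) : ∃ y, Tendsto (fun S => F S x) atTop (𝓝 y) := by
  have hv : ∀ v : Fin₀, ∃ y, Tendsto (fun S => F S (incl v)) atTop (𝓝 y) := fun v => by
    induction v using Finsupp.induction_linear with
    | zero => exact ⟨0, by simp⟩
    | add f g hf hg =>
      obtain ⟨y, hy⟩ := hf
      obtain ⟨z, hz⟩ := hg
      exact ⟨y + z, by simpa using hy.add hz⟩
    | single p c =>
      obtain ⟨y, hy⟩ := hk p
      exact ⟨c • y, by simpa [incl_single] using hy.const_smul c⟩
  refine cauchySeq_tendsto_of_complete (Metric.cauchySeq_iff'.2 fun ε hε => ?_)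
  obtain ⟨v, hxv⟩ := exists_incl_norm_sub_lt x (ε := ε / 3) (by positivity)
  obtain ⟨y, hy⟩ := hv v
  obtain ⟨N, hN⟩ := Metric.cauchySeq_iff'.1 hy.cauchySeq (ε / 3) (by positivity)
  refine ⟨N, fun n hn => ?_⟩
  have h1 : ∀ S, ‖F S x - F S (incl v)‖ < ε / 3 := fun S => by
    rw [← map_sub, hF]; exact hxv
  have h2 := hN n hn
  rw [dist_eq_norm] at h2 ⊢
  have h3 := h1 N
  rw [norm_sub_rev] at h3
  calc ‖F n x - F N x‖ = ‖(F n x - F n (incl v)) + (F n (incl v) - F N (incl v)) +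
        (F N (incl v) - F N x)‖ := by congr 1; abel
    _ ≤ _ := norm_add₃_le
    _ < ε := by linarith [h1 n]

/-- The component of a vector in the span of the number states in `S`. -/
noncomputable def cut (S : Finset (ℕ × ℕ)) : Fock →ₗ[ℂ] Fin₀ :=
  ∑ p ∈ S, (lsingle p) ∘ₗ (innerSL ℂ (ket p)).toLinearMap

theorem cut_apply (S : Finset (ℕ × ℕ)) (x : Fock) :
    cut S x = ∑ p ∈ S, single p ⟪ket p, x⟫ := by
  simp [cut, LinearMap.sum_apply]

theorem cut_ket (S : Finset (ℕ × ℕ)) (p : ℕ × ℕ) :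
    cut S (ket p) = if p ∈ S then single p 1 else 0 := by
  rw [cut_apply]
  split_ifs with h
  · rw [Finset.sum_eq_single_of_mem p h fun q _ hq => by
      rw [inner_ket_ket, if_neg hq, single_zero]]
    rw [inner_ket_ket, if_pos rfl]
  · exact Finset.sum_eq_zero fun q hq => by
      rw [inner_ket_ket, if_neg fun e => h (by rwa [← e]), single_zero]

theorem cut_incl {S : Finset (ℕ × ℕ)} {v : Fin₀} (h : v.support ⊆ S) : cut S (incl v) = v := by
  have : incl v = ∑ p ∈ v.support, v p • ket p := by
    simp [incl, linearCombination_apply, Finsupp.sum]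
  rw [this, map_sum]
  conv_rhs => rw [← v.sum_single]
  refine Finset.sum_congr rfl fun p hp => ?_
  rw [map_smul, cut_ket, if_pos (h hp)]
  simp

theorem inner_incl_cut (S : Finset (ℕ × ℕ)) (x y : Fock) :
    ⟪incl (cut S x), y⟫ = ⟪x, incl (cut S y)⟫ := by
  simp only [cut_apply, map_sum, incl_single, sum_inner, inner_sum, inner_smul_left,
    inner_smul_right]
  refine Finset.sum_congr rfl fun p _ => ?_
  rw [inner_conj_symm, mul_comm]

/-- The compression of the operator `A` to the span of the number states in `S`. -/
noncomputable def trunc (A : Module.End ℂ Fin₀) (S : Finset (ℕ × ℕ)) : Fock →L[ℂ] Fock :=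
  ∑ p ∈ S, (innerSL ℂ (ket p)).smulRight (incl (cut S (incl (A (single p 1)))))

theorem trunc_apply (A : Module.End ℂ Fin₀) (S : Finset (ℕ × ℕ)) (x : Fock) :
    trunc A S x = incl (cut S (incl (A (cut S x)))) := by
  rw [cut_apply S x]
  simp only [trunc, _root_.sum_apply, map_sum]
  refine Finset.sum_congr rfl fun p _ => ?_
  have : single p ⟪ket p, x⟫ = ⟪ket p, x⟫ • single p (1 : ℂ) := by simp
  rw [this]
  simp only [map_smul, ContinuousLinearMap.smulRight_apply, innerSL_apply_apply]

/-- Skew-symmetry on the finite linear combinations of number states. -/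
def IsSkew (A : Module.End ℂ Fin₀) : Prop :=
  ∀ u v : Fin₀, ⟪incl u, incl (A v)⟫ = -⟪incl (A u), incl v⟫

theorem trunc_mem_skewAdjoint {A : Module.End ℂ Fin₀} (hA : IsSkew A) (S : Finset (ℕ × ℕ)) :
    trunc A S ∈ skewAdjoint (Fock →L[ℂ] Fock) := by
  rw [skewAdjoint.mem_iff, ContinuousLinearMap.star_eq_adjoint, eq_comm,
    ContinuousLinearMap.eq_adjoint_iff]
  intro x y
  rw [_root_.neg_apply, inner_neg_left, trunc_apply, trunc_apply, inner_incl_cut,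
    ← inner_incl_cut S x, hA]

theorem norm_trunc_pow_le {A : Module.End ℂ Fin₀} {M : ℝ} (hM : 0 ≤ M) (hA : LinearGrowth A M)
    {S : Finset (ℕ × ℕ)} {p : ℕ × ℕ} (hp : p ∈ S) (k : ℕ) :
    ‖(trunc A S ^ k) (ket p)‖ ≤ k.factorial * 2 ^ (p.1 + p.2) * (4 * M) ^ k := by
  have := norm_le_factorial_of_linearGrowth
    -- The inner `cut S` makes `T (k + 1)` agree with `T k ∘ A` on states in `S` and vanish on the
    -- others.
    (T := fun k => (trunc A S ^ k).toLinearMap ∘ₗ incl ∘ₗ cut S ∘ₗ incl) hM hA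
    (fun p => ?_) (fun k p => ?_) k p
  · simpa only [LinearMap.comp_apply, ContinuousLinearMap.coe_coe, incl_single, one_smul, cut_ket,
      if_pos hp] using this
  · simp only [pow_zero, LinearMap.comp_apply, incl_single, one_smul, cut_ket]
    split_ifs <;> simp [incl_single, norm_ket]
  · simp only [pow_succ, LinearMap.comp_apply, incl_single, one_smul, cut_ket,
      ContinuousLinearMap.coe_coe, mul_apply_eq_comp]
    split_ifs with h
    · simp [trunc_apply, incl_single, cut_ket, h]
    · simp

/-- Only finitely many number states occur in `v, A v, …, Aᵏ v`; once `S` contains them, truncation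
changes nothing. -/
theorem eventually_trunc_pow_incl (A : Module.End ℂ Fin₀) (k : ℕ) (v : Fin₀) :
    ∀ᶠ S in atTop, (trunc A S ^ k) (incl v) = incl ((A ^ k) v) := by
  induction k generalizing v with
  | zero => simp
  | succ k ih =>
    filter_upwards [ih (A v), eventually_ge_atTop v.support, eventually_ge_atTop (A v).support]
      with S h1 h2 h3
    rw [pow_succ, pow_succ, mul_apply_eq_comp, trunc_apply, cut_incl h2, cut_incl h3,
      h1, Module.End.mul_apply]

/-- The unitary group generated by a truncated operator. -/
noncomputable def truncExp (A : Module.End ℂ Fin₀) (t : ℝ) (S : Finset (ℕ × ℕ)) : Fock →L[ℂ] Fock :=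
  NormedSpace.exp ((t : ℂ) • trunc A S)

theorem truncExp_add (A : Module.End ℂ Fin₀) (s t : ℝ) (S : Finset (ℕ × ℕ)) (x : Fock) :
    truncExp A (s + t) S x = truncExp A s S (truncExp A t S x) := by
  let _ : NormedAlgebra ℚ (Fock →L[ℂ] Fock) := .restrictScalars ℚ ℂ _
  rw [truncExp, ofReal_add, add_smul, NormedSpace.exp_add_of_commute, mul_apply_eq_comp]
  · rfl
  · exact ((Commute.refl _).smul_left _).smul_right _

theorem exp_mem_unitary_of_mem_skewAdjoint {H : Type*} [NormedAddCommGroup H]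
    [InnerProductSpace ℂ H] [CompleteSpace H] {T : H →L[ℂ] H}
    (hT : T ∈ skewAdjoint (H →L[ℂ] H)) : NormedSpace.exp T ∈ unitary (H →L[ℂ] H) :=
  let _ : NormedAlgebra ℚ (H →L[ℂ] H) := .restrictScalars ℚ ℂ _
  NormedSpace.exp_mem_unitary_of_mem_skewAdjoint hT

theorem ofReal_smul_mem_skewAdjoint {H : Type*} [NormedAddCommGroup H]
    [InnerProductSpace ℂ H] [CompleteSpace H] {T : H →L[ℂ] H}
    (hT : T ∈ skewAdjoint (H →L[ℂ] H)) (t : ℝ) : (t : ℂ) • T ∈ skewAdjoint (H →L[ℂ] H) := by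
  rw [skewAdjoint.mem_iff] at hT ⊢
  rw [star_smul, hT]
  simp

theorem norm_truncExp {A : Module.End ℂ Fin₀} (hA : IsSkew A) (t : ℝ) (S : Finset (ℕ × ℕ))
    (x : Fock) : ‖truncExp A t S x‖ = ‖x‖ :=
  ContinuousLinearMap.norm_map_of_mem_unitary (exp_mem_unitary_of_mem_skewAdjoint
    (ofReal_smul_mem_skewAdjoint (trunc_mem_skewAdjoint hA S) t)) x

theorem hasSum_truncExp (A : Module.End ℂ Fin₀) (t : ℝ) (S : Finset (ℕ × ℕ)) (x : Fock) :
    HasSum (fun k : ℕ => ((k.factorial : ℝ)⁻¹ * t ^ k) • (trunc A S ^ k) x) (truncExp A t S x) := by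
  have h := (NormedSpace.exp_series_hasSum_exp' (𝕂 := ℂ) ((t : ℂ) • trunc A S)).mapL
    (ContinuousLinearMap.apply ℂ Fock x)
  have e : (fun k : ℕ => ((k.factorial : ℝ)⁻¹ * t ^ k) • (trunc A S ^ k) x) = fun k : ℕ =>
      ContinuousLinearMap.apply ℂ Fock x ((k.factorial : ℂ)⁻¹ • ((t : ℂ) • trunc A S) ^ k) := by
    funext k
    rw [smul_pow, smul_smul, ContinuousLinearMap.apply_apply, _root_.smul_apply,
      RCLike.real_smul_eq_coe_smul (K := ℂ)]
    simp
  rw [e]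
  exact h

theorem norm_coeff_le {M t : ℝ} (hM : 0 ≤ M) (ht : |t| ≤ 1 / (8 * M + 1)) {C : ℝ} (hC : 0 ≤ C)
    {k : ℕ} {x : Fock} (hx : ‖x‖ ≤ k.factorial * C * (4 * M) ^ k) :
    ‖((k.factorial : ℝ)⁻¹ * t ^ k) • x‖ ≤ C * (1 / 2) ^ k := by
  have hq : 4 * M * |t| ≤ 1 / 2 := by
    have h2 : 4 * M * (1 / (8 * M + 1)) ≤ 1 / 2 := by
      rw [mul_one_div, div_le_div_iff₀ (by positivity) (by positivity)]
      linarith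
    exact (mul_le_mul_of_nonneg_left ht (by positivity)).trans h2
  have hf : (k.factorial : ℝ) ≠ 0 := by positivity
  calc _ = (k.factorial : ℝ)⁻¹ * |t| ^ k * ‖x‖ := by
        rw [norm_smul, norm_mul, norm_inv, norm_pow, Real.norm_eq_abs, Real.norm_eq_abs,
          Nat.abs_cast]
    _ ≤ (k.factorial : ℝ)⁻¹ * |t| ^ k * (k.factorial * C * (4 * M) ^ k) := by gcongr
    _ = C * (4 * M * |t|) ^ k := by rw [mul_pow (4 * M)]; field_simp
    _ ≤ _ := by gcongr

/-- Dominated convergence in the exponential series: each term is eventually constant in `S`, and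
the factorial bound gives a geometric majorant independent of `S`. -/
theorem tendsto_truncExp_ket {A : Module.End ℂ Fin₀} {M : ℝ} (hM : 0 ≤ M) (hA : LinearGrowth A M)
    {t : ℝ} (ht : |t| ≤ 1 / (8 * M + 1)) (p : ℕ × ℕ) :
    Tendsto (fun S => truncExp A t S (ket p)) atTop
      (𝓝 (∑' k : ℕ, ((k.factorial : ℝ)⁻¹ * t ^ k) • incl ((A ^ k) (single p 1)))) := by
  have h : Tendsto (fun S => ∑' k : ℕ, ((k.factorial : ℝ)⁻¹ * t ^ k) • (trunc A S ^ k) (ket p))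
      atTop (𝓝 (∑' k : ℕ, ((k.factorial : ℝ)⁻¹ * t ^ k) • incl ((A ^ k) (single p 1)))) := by
    refine tendsto_tsum_of_dominated_convergence
      (bound := fun k => 2 ^ (p.1 + p.2) * (1 / 2 : ℝ) ^ k) ?_ (fun k => ?_) ?_
    · exact summable_geometric_two.mul_left _
    · refine tendsto_const_nhds.congr' ?_
      filter_upwards [eventually_trunc_pow_incl A k (single p 1)] with S hS
      rw [← hS, incl_single, one_smul]
    · filter_upwards [eventually_ge_atTop {p}] with S hS k
      exact norm_coeff_le hM ht (by positivity) (norm_trunc_pow_le hM hA (by simpa using hS) k)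
  exact h.congr fun S => (hasSum_truncExp A t S (ket p)).tsum_eq

theorem exists_tendsto_truncExp {A : Module.End ℂ Fin₀} {M : ℝ} (hM : 0 ≤ M)
    (hA : LinearGrowth A M) (hs : IsSkew A) (t : ℝ) (x : Fock) :
    ∃ y, Tendsto (fun S => truncExp A t S x) atTop (𝓝 y) := by
  have key : ∀ n : ℕ, ∀ t : ℝ, |t| ≤ 1 / (8 * M + 1) → ∀ x,
      ∃ y, Tendsto (fun S => truncExp A (n * t) S x) atTop (𝓝 y) := fun n t ht => by
    induction n with
    | zero => exact fun x => ⟨x, by simp [truncExp, NormedSpace.exp_zero]⟩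
    | succ n ih =>
      intro x
      obtain ⟨y, hy⟩ := exists_tendsto_of_ket (F := truncExp A t) (norm_truncExp hs t)
        (fun p => ⟨_, tendsto_truncExp_ket hM hA ht p⟩) x
      obtain ⟨z, hz⟩ := ih y
      refine ⟨z, ?_⟩
      -- Strong limits compose because the truncated exponentials are isometries and do not enlarge
      -- the inner error.
      have h0 : Tendsto (fun S => truncExp A (n * t) S (truncExp A t S x - y)) atTop (𝓝 0) := by
        rw [tendsto_zero_iff_norm_tendsto_zero]
        simp only [norm_truncExp hs]
        exact tendsto_iff_norm_sub_tendsto_zero.1 hy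
      have h1 := h0.add hz
      rw [zero_add] at h1
      refine h1.congr fun S => ?_
      rw [← map_add, sub_add_cancel, ← truncExp_add]
      push_cast
      ring_nf
  obtain ⟨n, hn⟩ := exists_nat_ge (|t| * (8 * M + 1))
  have hM1 : 0 < 8 * M + 1 := by positivity
  have hn1 : (0 : ℝ) < n + 1 := by positivity
  obtain ⟨y, hy⟩ := key (n + 1) (t / (n + 1)) (by
    rw [abs_div, abs_of_pos hn1, div_le_div_iff₀ hn1 hM1]; linarith) x
  refine ⟨y, ?_⟩
  convert hy using 3
  push_cast
  field_simp

theorem hasDerivAt_of_hasSum_pow {E : Type*} [NormedAddCommGroup E] [NormedSpace ℝ E]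
    {f : ℝ → E} {c : ℕ → E} (h : ∀ᶠ t in 𝓝 (0 : ℝ), HasSum (fun k => t ^ k • c k) (f t)) :
    HasDerivAt f (c 1) 0 := by
  have := (hasFPowerSeriesAt_iff (𝕜 := ℝ) (f := f) (z₀ := 0)
    (p := fun n => ContinuousMultilinearMap.mkPiRing ℝ (Fin n) (c n))).2 (by
      simpa [FormalMultilinearSeries.coeff] using h)
  simpa using this.hasDerivAt

/-- A skew-symmetric operator of linear growth is essentially skew-adjoint on the number states:
it generates a unitary group. -/
theorem exists_isUnitaryGroup {A : Module.End ℂ Fin₀} {M : ℝ} (hM : 0 ≤ M)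
    (hA : LinearGrowth A M) (hs : IsSkew A) : ∃ U, IsUnitaryGroup A U := by
  choose W hW using exists_tendsto_truncExp hM hA hs
  have W_norm : ∀ t x, ‖W t x‖ = ‖x‖ := fun t x =>
    tendsto_nhds_unique (hW t x).norm (by simp only [norm_truncExp hs]; exact tendsto_const_nhds)
  have W_map_add : ∀ t x y, W t (x + y) = W t x + W t y := fun t x y =>
    tendsto_nhds_unique (hW t (x + y)) (by simpa using (hW t x).add (hW t y))
  have W_map_smul : ∀ t (c : ℂ) x, W t (c • x) = c • W t x := fun t c x =>
    tendsto_nhds_unique (hW t (c • x)) (by simpa using (hW t x).const_smul c)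
  have W_zero : ∀ x, W 0 x = x := fun x =>
    tendsto_nhds_unique (hW 0 x) (by simp [truncExp, NormedSpace.exp_zero])
  have W_add : ∀ s t x, W (s + t) x = W s (W t x) := fun s t x => by
    refine tendsto_nhds_unique (hW (s + t) x) ?_
    have h0 : Tendsto (fun S => truncExp A s S (truncExp A t S x - W t x)) atTop (𝓝 0) := by
      rw [tendsto_zero_iff_norm_tendsto_zero]
      simp only [norm_truncExp hs]
      exact tendsto_iff_norm_sub_tendsto_zero.1 (hW t x)
    have h1 := h0.add (hW s (W t x))
    rw [zero_add] at h1
    refine h1.congr fun S => ?_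
    rw [← map_add, sub_add_cancel, ← truncExp_add]
  let U : ℝ → (Fock ≃ₗᵢ[ℂ] Fock) := fun t =>
    { toFun := W t
      map_add' := W_map_add t
      map_smul' := W_map_smul t
      invFun := W (-t)
      left_inv := fun x => by rw [← W_add, neg_add_cancel, W_zero]
      right_inv := fun x => by rw [← W_add, add_neg_cancel, W_zero]
      norm_map' := W_norm t }
  have hU : ∀ t x, U t x = W t x := fun _ _ => rfl
  have U_add : ∀ s t x, U (s + t) x = U s (U t x) := W_add
  have U_deriv : ∀ v : Fin₀, HasDerivAt (fun t => U t (incl v)) (incl (A v)) 0 := fun v => by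
    induction v using Finsupp.induction_linear with
    | zero => simpa using hasDerivAt_const (0 : ℝ) (0 : Fock)
    | add f g hf hg =>
      simp only [map_add]
      exact hf.add hg
    | single p c =>
      have hk : HasDerivAt (fun t => U t (ket p)) (incl (A (single p 1))) 0 := by
        -- Near 0 the orbit is a convergent power series, and its linear coefficient is `A|p⟩`.
        have := hasDerivAt_of_hasSum_pow (f := fun t => U t (ket p))
          (c := fun k => ((k.factorial : ℝ)⁻¹) • incl ((A ^ k) (single p 1))) (by
            have hr : (0 : ℝ) < 1 / (8 * M + 1) := by positivity
            filter_upwards [Metric.closedBall_mem_nhds (0 : ℝ) hr] with t ht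
            have ht' : |t| ≤ 1 / (8 * M + 1) := by simpa using ht
            have e : ∀ k : ℕ, t ^ k • ((k.factorial : ℝ)⁻¹) • incl ((A ^ k) (single p 1)) =
                ((k.factorial : ℝ)⁻¹ * t ^ k) • incl ((A ^ k) (single p 1)) := fun k => by
              rw [smul_smul, mul_comm]
            simp only [e]
            rw [hU, tendsto_nhds_unique (hW t (ket p)) (tendsto_truncExp_ket hM hA ht' p)]
            refine Summable.hasSum (Summable.of_norm_bounded
              (g := fun k => 2 ^ (p.1 + p.2) * (1 / 2 : ℝ) ^ k)
              (summable_geometric_two.mul_left _) fun k => ?_)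
            exact norm_coeff_le hM ht' (by positivity) (norm_incl_pow_le hM hA k p))
        simpa using this
      have e : single p c = c • single p (1 : ℂ) := by simp
      rw [e]
      simp only [map_smul, incl_single, one_smul]
      exact hk.const_smul c
  refine ⟨U, W_zero, U_add, fun x => ?_, U_deriv⟩
  -- Isometry makes the approximation of `x` by finite combinations uniform in time along the
  -- orbits.
  refine continuous_of_uniform_approx_of_continuous fun u hu => ?_
  obtain ⟨ε, hε, hεu⟩ := Metric.mem_uniformity_dist.1 hu
  obtain ⟨v, hv⟩ := exists_incl_norm_sub_lt x hε
  refine ⟨fun t => U t (incl v), ?_, fun t => hεu ?_⟩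
  · exact continuous_iff_continuousAt.2 fun t =>
      (hasDerivAt_group U_add (U_deriv v) t).continuousAt
  · rwa [dist_eq_norm, ← map_sub, LinearIsometryEquiv.norm_map]

theorem existsUnique_quadGen (θ : ℝ) (w : ℂ) : ∃! U, IsUnitaryGroup (quadGen θ w) U := by
  obtain ⟨U, hU⟩ := exists_isUnitaryGroup (by positivity) (quadGen_linearGrowth θ w)
    (quadGen_skew θ w)
  exact ⟨U, hU, fun V hV => hV.unique (by positivity) (quadGen_linearGrowth θ w) hU⟩

theorem unitaryExp_quadGen_apply {θ : ℝ} {w : ℂ} {y : ℝ → Fock}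
    (hy : IsWeakSolution (quadGen θ w) y) {K : ℝ} (hK : ∀ t, ‖y t‖ ≤ K) :
    unitaryExp (quadGen θ w) (y 0) = y 1 := by
  have h := existsUnique_quadGen θ w
  rw [unitaryExp, dif_pos h]
  exact h.choose_spec.1.eq_of_isWeakSolution (by positivity) (quadGen_linearGrowth θ w) hy hK
    zero_le_one

/-! ### Geometric twin states and the Riccati equation. -/

/-- The geometric superposition `∑ zⁿ |n⟩|n⟩` of the twin number states. -/
noncomputable def geo (z : ℂ) : Fock := ∑' n : ℕ, z ^ n • ket (n, n)

theorem hasSum_geo {z : ℂ} (hz : ‖z‖ < 1) : HasSum (fun n : ℕ => z ^ n • ket (n, n)) (geo z) := by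
  refine Summable.hasSum (Summable.of_norm_bounded
    (summable_geometric_of_lt_one (norm_nonneg z) hz) fun n => ?_)
  rw [norm_smul, norm_ket, norm_pow, mul_one]

theorem inner_ket_geo {z : ℂ} (hz : ‖z‖ < 1) (m n : ℕ) :
    ⟪ket (m, n), geo z⟫ = if m = n then z ^ m else 0 := by
  refine ((hasSum_geo hz).mapL (innerSL ℂ (ket (m, n)))).unique ?_
  have e : (fun k : ℕ => innerSL ℂ (ket (m, n)) (z ^ k • ket (k, k))) =
      fun k => if k = m then (if m = n then z ^ m else 0) else 0 := by
    funext k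
    simp only [map_smul, innerSL_apply_apply, inner_ket_ket, Prod.mk.injEq, smul_eq_mul]
    split_ifs <;> first | omega | simp_all
  rw [e]
  exact hasSum_ite_eq m _

theorem inner_geo_geo {z w : ℂ} (hz : ‖z‖ < 1) (hw : ‖w‖ < 1) :
    ⟪geo z, geo w⟫ = (1 - starRingEnd ℂ z * w)⁻¹ := by
  refine ((hasSum_geo hw).mapL (innerSL ℂ (geo z))).unique ?_
  have h : ‖starRingEnd ℂ z * w‖ < 1 := by
    rw [norm_mul, RCLike.norm_conj]
    exact mul_lt_one_of_nonneg_of_lt_one_left (norm_nonneg z) hz hw.le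
  convert hasSum_geometric_of_norm_lt_one h using 2 with n
  rw [map_smul, innerSL_apply_apply, ← inner_conj_symm, inner_ket_geo hz]
  simp [mul_pow, mul_comm]

theorem geo_zero : geo 0 = vac := by
  rw [geo, tsum_eq_single 0 fun n hn => by simp [hn]]
  simp [vac]

/-- A twin geometric superposition whose parameters satisfy the Riccati equations evolves according
to the quadratic generator. -/
theorem isWeakSolution_geo {θ : ℝ} {w : ℂ} {c z : ℝ → ℂ} (hz : ∀ t, ‖z t‖ < 1)
    (hc' : ∀ t, HasDerivAt c (-I * (starRingEnd ℂ w * z t * c t)) t)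
    (hz' : ∀ t, HasDerivAt z (-I * (2 * θ * z t + w + starRingEnd ℂ w * z t ^ 2)) t) :
    IsWeakSolution (quadGen θ w) fun t => c t • geo (z t) := fun v t => by
  induction v using Finsupp.induction_linear with
  | zero => simpa using hasDerivAt_const t (0 : ℂ)
  | add f g hf hg =>
    simp only [map_add, inner_add_left]
    exact (hf.add hg).congr_deriv (by ring)
  | single p d =>
    obtain ⟨m, n⟩ := p
    have e : single (m, n) d = d • single (m, n) (1 : ℂ) := by simp
    rw [e]
    simp only [map_smul, incl_single, one_smul, inner_smul_left]
    suffices h : HasDerivAt (fun t => ⟪ket (m, n), c t • geo (z t)⟫)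
        (-⟪incl (quadGen θ w (single (m, n) 1)), c t • geo (z t)⟫) t from
      (h.const_mul _).congr_deriv (by ring)
    simp only [quadGen_single, map_add, map_smul, incl_single, one_smul, inner_add_left,
      inner_smul_left, inner_smul_right, inner_ket_geo (hz _)]
    by_cases hmn : m = n
    · subst hmn
      have k1 : √((m : ℝ) + 1) * √((m : ℝ) + 1) = m + 1 := Real.mul_self_sqrt (by positivity)
      have k2 : √(m : ℝ) * √(m : ℝ) = m := Real.mul_self_sqrt (by positivity)
      simp only [if_true, k1, k2, map_mul, map_neg, conj_I, conj_ofReal, conj_conj, map_add,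
        map_natCast]
      -- The coefficient `c zᵐ` is coupled to `c zᵐ⁻¹` with weight `m` and to `c zᵐ⁺¹` with weight
      -- `m + 1`. The part of its logarithmic derivative proportional to `m` is the equation for
      -- `z`; the rest is that for `c`.
      refine ((hc' t).mul ((hz' t).pow m)).congr_deriv ?_
      cases m with
      | zero => simp; ring
      | succ k =>
        simp only [Nat.add_sub_cancel, Pi.pow_apply]
        push_cast
        ring
    · have h1 : m + 1 ≠ n + 1 := by omega
      simp only [if_neg hmn, if_neg h1, mul_zero, zero_add, add_zero]
      -- Truncated subtraction gives `m - 1 = n - 1` with `m ≠ n` only if one index is 0, and then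
      -- the coefficient vanishes.
      have h2 : (starRingEnd ℂ) (-I * ((starRingEnd ℂ) w * ((√(m : ℝ) * √(n : ℝ) : ℝ) : ℂ))) *
          (if m - 1 = n - 1 then z t ^ (m - 1) else 0) = 0 := by
        split_ifs with h
        · have : m = 0 ∨ n = 0 := by omega
          rcases this with h | h <;> simp [h]
        · simp
      rw [h2, mul_zero, neg_zero]
      exact hasDerivAt_const t (0 : ℂ)

/-! ### Explicit evolution of the vacuum for `θ² < |w|²`. -/

/-- The denominator `μ cosh(μt) + iθ sinh(μt)` of the solution of the Riccati equation. -/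
noncomputable def denom (θ mu t : ℝ) : ℂ := ⟨mu * Real.cosh (mu * t), θ * Real.sinh (mu * t)⟩

theorem denom_ne_zero {θ mu : ℝ} (hmu : 0 < mu) (t : ℝ) : denom θ mu t ≠ 0 := fun h => by
  have : mu * Real.cosh (mu * t) = 0 := congrArg re h
  exact (mul_pos hmu (Real.cosh_pos _)).ne' this

theorem denom_eq (θ mu t : ℝ) :
    denom θ mu t = mu * (Real.cosh (mu * t) : ℝ) + I * θ * (Real.sinh (mu * t) : ℝ) := by
  apply Complex.ext <;>
    simp only [denom, add_re, add_im, mul_re, mul_im, ofReal_re, ofReal_im, I_re, I_im] <;> ring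

theorem hasDerivAt_denom (θ mu t : ℝ) :
    HasDerivAt (denom θ mu)
      (mu * (mu * (Real.sinh (mu * t) : ℝ) + I * θ * (Real.cosh (mu * t) : ℝ))) t := by
  have h1 : HasDerivAt (fun t => mu * t) mu t := by simpa using (hasDerivAt_id t).const_mul mu
  have hc := (h1.cosh.ofReal_comp).const_mul (mu : ℂ)
  have hs := (h1.sinh.ofReal_comp).const_mul (I * θ)
  have := hc.add hs
  rw [show denom θ mu = _ from funext (denom_eq θ mu)]
  refine this.congr_deriv ?_
  push_cast
  ring

theorem normSq_denom {θ mu : ℝ} {w : ℂ} (hmu : mu ^ 2 = ‖w‖ ^ 2 - θ ^ 2) (t : ℝ) :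
    ‖denom θ mu t‖ ^ 2 = mu ^ 2 + ‖w‖ ^ 2 * Real.sinh (mu * t) ^ 2 := by
  rw [← normSq_eq_norm_sq, normSq_apply]
  simp only [denom]
  have := Real.cosh_sq (mu * t)
  linear_combination mu ^ 2 * this + Real.sinh (mu * t) ^ 2 * hmu

/-- The ratio of successive amplitudes of the evolved vacuum. -/
noncomputable def ratio (θ mu : ℝ) (w : ℂ) (t : ℝ) : ℂ :=
  -I * w * (Real.sinh (mu * t) : ℝ) / denom θ mu t

/-- The vacuum amplitude of the evolved vacuum. -/
noncomputable def ampl (θ mu t : ℝ) : ℂ := mu * exp (I * θ * t) / denom θ mu t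

theorem one_sub_norm_ratio_sq {θ mu : ℝ} {w : ℂ} (h0 : 0 < mu) (hmu : mu ^ 2 = ‖w‖ ^ 2 - θ ^ 2)
    (t : ℝ) : 1 - ‖ratio θ mu w t‖ ^ 2 = mu ^ 2 / ‖denom θ mu t‖ ^ 2 := by
  have hd : ‖denom θ mu t‖ ≠ 0 := norm_ne_zero_iff.2 (denom_ne_zero h0 t)
  rw [ratio, norm_div, norm_mul, norm_mul, norm_neg, norm_I, one_mul, norm_real,
    Real.norm_eq_abs, div_pow, mul_pow, sq_abs]
  field_simp
  rw [normSq_denom hmu]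
  ring

theorem norm_ratio_lt_one {θ mu : ℝ} {w : ℂ} (h0 : 0 < mu) (hmu : mu ^ 2 = ‖w‖ ^ 2 - θ ^ 2)
    (t : ℝ) : ‖ratio θ mu w t‖ < 1 := by
  have h1 : 0 < 1 - ‖ratio θ mu w t‖ ^ 2 := by
    rw [one_sub_norm_ratio_sq h0 hmu]
    have : 0 < ‖denom θ mu t‖ := norm_pos_iff.2 (denom_ne_zero h0 t)
    positivity
  exact (sq_lt_one_iff₀ (norm_nonneg _)).1 (by linarith)

theorem norm_ampl_sq (θ mu t : ℝ) : ‖ampl θ mu t‖ ^ 2 = mu ^ 2 / ‖denom θ mu t‖ ^ 2 := by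
  have : ‖exp (I * θ * t)‖ = 1 := by
    rw [show I * θ * t = ((θ * t : ℝ) : ℂ) * I by push_cast; ring, norm_exp_ofReal_mul_I]
  rw [ampl, norm_div, norm_mul, this, norm_real, Real.norm_eq_abs, div_pow, mul_one, sq_abs]

/-- Since `|c|² = 1 - |z|² = μ² / |D|²`, normalization cancels exactly. This supplies the
boundedness that the uniqueness theorem requires. -/
theorem norm_ampl_smul_geo {θ mu : ℝ} {w : ℂ} (h0 : 0 < mu) (hmu : mu ^ 2 = ‖w‖ ^ 2 - θ ^ 2)
    (t : ℝ) : ‖ampl θ mu t • geo (ratio θ mu w t)‖ = 1 := by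
  have hz := norm_ratio_lt_one h0 hmu t
  have hd : ‖denom θ mu t‖ ≠ 0 := norm_ne_zero_iff.2 (denom_ne_zero h0 t)
  have h1 : ‖geo (ratio θ mu w t)‖ ^ 2 = (1 - ‖ratio θ mu w t‖ ^ 2)⁻¹ := by
    have := inner_self_eq_norm_sq_to_K (𝕜 := ℂ) (geo (ratio θ mu w t))
    rw [inner_geo_geo hz hz, ← normSq_eq_conj_mul_self, normSq_eq_norm_sq] at this
    apply ofReal_injective
    push_cast at this ⊢
    exact this.symm
  have h2 : ‖ampl θ mu t • geo (ratio θ mu w t)‖ ^ 2 = 1 := by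
    rw [norm_smul, mul_pow, h1, norm_ampl_sq, one_sub_norm_ratio_sq h0 hmu]
    field_simp
  exact (pow_eq_one_iff_of_nonneg (norm_nonneg _) two_ne_zero).1 h2

theorem hasDerivAt_ampl {θ mu : ℝ} {w : ℂ} (h0 : 0 < mu) (hmu : mu ^ 2 = ‖w‖ ^ 2 - θ ^ 2)
    (t : ℝ) : HasDerivAt (ampl θ mu)
      (-I * (starRingEnd ℂ w * ratio θ mu w t * ampl θ mu t)) t := by
  have hD := denom_ne_zero (θ := θ) h0 t
  have h1 : HasDerivAt (fun t : ℝ => I * θ * (t : ℂ)) (I * θ) t := by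
    simpa using (hasDerivAt_id t).ofReal_comp.const_mul (I * θ)
  refine ((h1.cexp.const_mul (mu : ℂ)).div (hasDerivAt_denom θ mu t) hD).congr_deriv ?_
  have hw : w * starRingEnd ℂ w = mu ^ 2 + θ ^ 2 := by
    rw [mul_conj, normSq_eq_norm_sq]
    norm_cast
    linarith
  rw [ratio, ampl]
  field_simp
  rw [denom_eq]
  linear_combination -(mu * (Real.sinh (mu * t) : ℝ) * I ^ 2) * hw -
    mu ^ 3 * (Real.sinh (mu * t) : ℝ) * I_sq

theorem hasDerivAt_ratio {θ mu : ℝ} {w : ℂ} (h0 : 0 < mu) (hmu : mu ^ 2 = ‖w‖ ^ 2 - θ ^ 2)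
    (t : ℝ) : HasDerivAt (ratio θ mu w)
      (-I * (2 * θ * ratio θ mu w t + w + starRingEnd ℂ w * ratio θ mu w t ^ 2)) t := by
  have hD := denom_ne_zero (θ := θ) h0 t
  have h1 : HasDerivAt (fun t => mu * t) mu t := by simpa using (hasDerivAt_id t).const_mul mu
  refine (((h1.sinh.ofReal_comp).const_mul (-I * w)).div
    (hasDerivAt_denom θ mu t) hD).congr_deriv ?_
  have hw : w * starRingEnd ℂ w = mu ^ 2 + θ ^ 2 := by
    rw [mul_conj, normSq_eq_norm_sq]
    norm_cast
    linarith
  rw [ratio]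
  field_simp
  rw [denom_eq]
  simp only [ofReal_mul]
  linear_combination w * I ^ 2 * (Real.sinh (mu * t) : ℝ) ^ 2 * hw +
    w * mu ^ 2 * (Real.sinh (mu * t) : ℝ) ^ 2 * I_sq

/-- The evolution of the vacuum under the quadratic generator in the hyperbolic regime. -/
theorem unitaryExp_quadGen_vac {θ mu : ℝ} {w : ℂ} (h0 : 0 < mu)
    (hmu : mu ^ 2 = ‖w‖ ^ 2 - θ ^ 2) :
    unitaryExp (quadGen θ w) vac = ampl θ mu 1 • geo (ratio θ mu w 1) := by
  have := unitaryExp_quadGen_apply (isWeakSolution_geo (norm_ratio_lt_one h0 hmu)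
    (hasDerivAt_ampl h0 hmu) (hasDerivAt_ratio h0 hmu))
    (fun t => (norm_ampl_smul_geo h0 hmu t).le)
  have e : ampl θ mu 0 • geo (ratio θ mu w 0) = vac := by
    have : (mu : ℂ) ≠ 0 := by exact_mod_cast h0.ne'
    simp [ampl, ratio, denom_eq, geo_zero, this]
  rwa [e] at this

/-! ### Part (i): matching the squeezing parameters. -/

theorem squeezedVac_eq {f : ℝ} (hf : 0 < f) {u : ℂ} (hu : ‖u‖ = 1) :
    squeezedVac (f * u) =
      ((Real.cosh f : ℝ) : ℂ)⁻¹ • geo (u * ((Real.sinh f : ℝ) / (Real.cosh f : ℝ))) := by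
  have h := unitaryExp_quadGen_vac (θ := 0) (mu := f) (w := I * (f * u)) hf
    (by simp [hu])
  have hf' : (f : ℂ) ≠ 0 := by exact_mod_cast hf.ne'
  have hc : ((Real.cosh f : ℝ) : ℂ) ≠ 0 := by exact_mod_cast (Real.cosh_pos f).ne'
  rw [squeezedVac, squeezeGen_eq, h]
  congr 2
  · rw [ampl, denom_eq]
    simp only [ofReal_zero, mul_one, mul_zero, zero_mul, exp_zero, add_zero]
    field_simp
  · rw [ratio, denom_eq]
    simp only [ofReal_zero, mul_one, mul_zero, zero_mul, add_zero]
    field_simp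
    rw [I_sq]
    ring

theorem norm_exp_I_mul_ofReal (x : ℝ) : ‖exp (I * x)‖ = 1 := by
  rw [mul_comm, norm_exp_ofReal_mul_I]

theorem exp_I_mul_pi_add_arccos {x : ℝ} (h1 : -1 ≤ x) (h2 : x ≤ 1) :
    exp (I * ((Real.pi + Real.arccos x : ℝ) : ℂ)) = -(x + I * (√(1 - x ^ 2) : ℝ)) := by
  rw [mul_comm, exp_mul_I, ← ofReal_cos, ← ofReal_sin, add_comm Real.pi, Real.cos_add_pi,
    Real.sin_add_pi, Real.cos_arccos h1 h2, Real.sin_arccos]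
  push_cast
  ring

theorem sqrt_sub_sq_pos {lam θ : ℝ} (h : θ ^ 2 < lam ^ 2) : 0 < √(lam ^ 2 - θ ^ 2) :=
  Real.sqrt_pos.2 (by linarith)

theorem sq_sqrt_sub_sq {lam θ : ℝ} (h : θ ^ 2 < lam ^ 2) :
    √(lam ^ 2 - θ ^ 2) ^ 2 = lam ^ 2 - θ ^ 2 := Real.sq_sqrt (by linarith)

theorem outState_eq {lam θ : ℝ} (h : θ ^ 2 < lam ^ 2) : outState lam θ =
    ampl θ √(lam ^ 2 - θ ^ 2) 1 • geo (ratio θ √(lam ^ 2 - θ ^ 2) lam 1) := by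
  rw [outState, hamiltonian_eq, unitaryExp_quadGen_vac (sqrt_sub_sq_pos h)]
  rw [sq_sqrt_sub_sq h, norm_real, Real.norm_eq_abs, sq_abs]

theorem norm_denom_sq {lam θ : ℝ} (h : θ ^ 2 < lam ^ 2) :
    ‖denom θ √(lam ^ 2 - θ ^ 2) 1‖ ^ 2 =
      -θ ^ 2 + lam ^ 2 * Real.cosh √(lam ^ 2 - θ ^ 2) ^ 2 := by
  rw [normSq_denom (w := (lam : ℂ)) (by
    rw [sq_sqrt_sub_sq h, norm_real, Real.norm_eq_abs, sq_abs]), norm_real, Real.norm_eq_abs,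
    sq_abs, mul_one, Real.cosh_sq, sq_sqrt_sub_sq h]
  ring

theorem cosh_two_mul_sqF {lam θ : ℝ} (h : θ ^ 2 < lam ^ 2) :
    Real.cosh (2 * sqF lam θ) =
      (-θ ^ 2 + lam ^ 2 * Real.cosh (2 * √(lam ^ 2 - θ ^ 2))) / (lam ^ 2 - θ ^ 2) := by
  have h0 : 0 < lam ^ 2 - θ ^ 2 := by linarith
  rw [sqF, show ∀ x : ℝ, 2 * (1 / 2 * x) = x by intro x; ring, Real.cosh_arcosh]
  rw [le_div_iff₀ h0]
  nlinarith [Real.one_le_cosh (2 * √(lam ^ 2 - θ ^ 2)), sq_nonneg lam]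

theorem cosh_sqF {lam θ : ℝ} (h : θ ^ 2 < lam ^ 2) :
    Real.cosh (sqF lam θ) = ‖denom θ √(lam ^ 2 - θ ^ 2) 1‖ / √(lam ^ 2 - θ ^ 2) := by
  have hmu := sqrt_sub_sq_pos h
  rw [← pow_left_inj₀ (Real.cosh_pos _).le (by positivity) two_ne_zero, div_pow, norm_denom_sq h]
  have h1 := cosh_two_mul_sqF h
  have h0 : lam ^ 2 - θ ^ 2 ≠ 0 := by linarith
  rw [Real.cosh_two_mul, Real.sinh_sq, Real.cosh_two_mul, Real.sinh_sq] at h1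
  rw [sq_sqrt_sub_sq h]
  field_simp at h1 ⊢
  linarith

theorem sqF_pos {lam θ : ℝ} (h : θ ^ 2 < lam ^ 2) : 0 < sqF lam θ := by
  have hmu := sqrt_sub_sq_pos h
  have h0 : 0 < lam ^ 2 - θ ^ 2 := by linarith
  refine mul_pos (by norm_num) (Real.arcosh_pos ?_)
  rw [lt_div_iff₀ h0]
  have : 1 < Real.cosh (2 * √(lam ^ 2 - θ ^ 2)) := Real.one_lt_cosh.2 (by positivity)
  nlinarith [(sq_nonneg θ).trans_lt h]

theorem sinh_sqF {lam θ : ℝ} (hlam : 0 < lam) (h : θ ^ 2 < lam ^ 2) :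
    Real.sinh (sqF lam θ) =
      lam * Real.sinh √(lam ^ 2 - θ ^ 2) / √(lam ^ 2 - θ ^ 2) := by
  have hmu := sqrt_sub_sq_pos h
  have hs := Real.sinh_pos_iff.2 hmu
  rw [← pow_left_inj₀ (Real.sinh_pos_iff.2 (sqF_pos h)).le (by positivity) two_ne_zero,
    Real.sinh_sq, cosh_sqF h, div_pow, div_pow, norm_denom_sq h, mul_pow, Real.sinh_sq,
    sq_sqrt_sub_sq h]
  have h0 : lam ^ 2 - θ ^ 2 ≠ 0 := by linarith
  field_simp
  ring

theorem denom_mul_conj (θ mu t : ℝ) :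
    denom θ mu t * starRingEnd ℂ (denom θ mu t) = (‖denom θ mu t‖ : ℂ) ^ 2 := by
  rw [mul_conj, normSq_eq_norm_sq, ofReal_pow]

theorem conj_denom (θ mu t : ℝ) : starRingEnd ℂ (denom θ mu t) =
    mu * (Real.cosh (mu * t) : ℝ) - I * θ * (Real.sinh (mu * t) : ℝ) := by
  rw [denom_eq]
  simp only [map_add, map_mul, conj_ofReal, conj_I]
  ring

theorem exp_sqXi {lam θ : ℝ} (h : θ ^ 2 < lam ^ 2) :
    exp (I * sqXi lam θ) = -I * starRingEnd ℂ (denom θ √(lam ^ 2 - θ ^ 2) 1) /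
      (‖denom θ √(lam ^ 2 - θ ^ 2) 1‖ : ℂ) := by
  have hmu := sqrt_sub_sq_pos h
  have hN : 0 < ‖denom θ √(lam ^ 2 - θ ^ 2) 1‖ := norm_pos_iff.2 (denom_ne_zero hmu 1)
  have hN2 := norm_denom_sq h
  have hc := Real.cosh_sq √(lam ^ 2 - θ ^ 2)
  have hm := sq_sqrt_sub_sq h
  set mu := √(lam ^ 2 - θ ^ 2) with hmu_def
  set N := ‖denom θ mu 1‖ with hN_def
  have hsq : √(-θ ^ 2 + lam ^ 2 * Real.cosh mu ^ 2) = N := by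
    rw [← hN2, Real.sqrt_sq hN.le]
  -- The real and imaginary parts of `D` are the legs of a right triangle with hypotenuse `N`, so
  -- the arccosine in `ξ` is an angle of it.
  have hx : 1 - (θ * Real.sinh mu / N) ^ 2 = (mu * Real.cosh mu / N) ^ 2 := by
    field_simp
    rw [hN2]
    linear_combination θ ^ 2 * hc - Real.cosh mu ^ 2 * hm
  have hx1 : (θ * Real.sinh mu / N) ^ 2 ≤ 1 := by
    nlinarith [sq_nonneg (mu * Real.cosh mu / N)]
  have hx2 := abs_le.1 ((sq_le_one_iff_abs_le_one _).1 hx1)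
  have hroot : √(1 - (θ * Real.sinh mu / N) ^ 2) = mu * Real.cosh mu / N := by
    rw [hx, Real.sqrt_sq (div_nonneg (mul_nonneg hmu.le (Real.cosh_pos _).le) hN.le)]
  rw [sqXi, ← hmu_def, hsq, exp_I_mul_pi_add_arccos hx2.1 hx2.2, hroot, conj_denom, mul_one]
  have hN' : (N : ℂ) ≠ 0 := by exact_mod_cast hN.ne'
  push_cast
  field_simp
  linear_combination -θ * (sinh mu) * I_sq

theorem outState_eq_squeezedVac {lam θ : ℝ} (hlam : 0 < lam) (h : θ ^ 2 < lam ^ 2) :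
    outState lam θ = (I * exp (I * (θ + sqXi lam θ))) •
      squeezedVac (sqF lam θ * exp (I * sqXi lam θ)) := by
  have hmu := sqrt_sub_sq_pos h
  have hD := denom_ne_zero (θ := θ) hmu 1
  have hN : (‖denom θ √(lam ^ 2 - θ ^ 2) 1‖ : ℂ) ≠ 0 := by
    exact_mod_cast (norm_pos_iff.2 hD).ne'
  have hconj := denom_mul_conj θ √(lam ^ 2 - θ ^ 2) 1
  rw [squeezedVac_eq (sqF_pos h) (norm_exp_I_mul_ofReal _), outState_eq h, smul_smul,
    mul_add I, exp_add, cosh_sqF h, sinh_sqF hlam h, exp_sqXi h, ampl, ratio]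
  have hmu' : ((√(lam ^ 2 - θ ^ 2) : ℝ) : ℂ) ≠ 0 := by exact_mod_cast hmu.ne'
  set mu := √(lam ^ 2 - θ ^ 2)
  congr 1
  · push_cast
    rw [mul_one]
    field_simp
    linear_combination -hconj + starRingEnd ℂ (denom θ mu 1) * denom θ mu 1 * I_sq
  · congr 1
    push_cast
    rw [mul_one]
    field_simp
    linear_combination lam * sinh mu * hconj

/-! ### Part (ii): overlap and the limit of large `λ`. -/

/-- The overlap of the output state with the two-mode squeezed vacuum. -/
theorem inner_outState_squeezedVac {lam θ : ℝ} (hlam : 0 < lam) (h : θ ^ 2 < lam ^ 2) :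
    ⟪exp (-I * θ) • outState lam θ, squeezedVac (√(lam ^ 2 - θ ^ 2) *
        exp (I * (Real.pi + Real.arccos (θ / lam))))⟫ =
      √(lam ^ 2 - θ ^ 2) / (√(lam ^ 2 - θ ^ 2) - I * (θ * ((Real.sinh √(lam ^ 2 - θ ^ 2) *
        (Real.cosh √(lam ^ 2 - θ ^ 2) - Real.sinh √(lam ^ 2 - θ ^ 2)) : ℝ) : ℂ))) := by
  have hmu := sqrt_sub_sq_pos h
  have hm := sq_sqrt_sub_sq h
  have hroot : √(1 - (θ / lam) ^ 2) = √(lam ^ 2 - θ ^ 2) / lam := by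
    rw [show 1 - (θ / lam) ^ 2 = (lam ^ 2 - θ ^ 2) / lam ^ 2 by field_simp,
      Real.sqrt_div (by linarith), Real.sqrt_sq hlam.le]
  have hx := abs_le.1 ((sq_le_one_iff_abs_le_one (θ / lam)).1 (by
    rw [div_pow, div_le_one (by positivity)]; exact h.le))
  have hu := exp_I_mul_pi_add_arccos hx.1 hx.2
  have hz2 : ‖exp (I * ((Real.pi + Real.arccos (θ / lam) : ℝ) : ℂ)) *
      ((Real.sinh √(lam ^ 2 - θ ^ 2) : ℝ) / (Real.cosh √(lam ^ 2 - θ ^ 2) : ℝ))‖ < 1 := by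
    rw [norm_mul, norm_exp_I_mul_ofReal, one_mul, ← ofReal_div, norm_real, Real.norm_eq_abs,
      abs_of_nonneg (div_nonneg (Real.sinh_pos_iff.2 hmu).le (Real.cosh_pos _).le),
      div_lt_one (Real.cosh_pos _)]
    exact Real.sinh_lt_cosh _
  have hz1 : ‖ratio θ √(lam ^ 2 - θ ^ 2) lam 1‖ < 1 :=
    norm_ratio_lt_one hmu (by rw [hm, norm_real, Real.norm_eq_abs, sq_abs]) 1
  rw [← ofReal_add, squeezedVac_eq hmu (norm_exp_I_mul_ofReal _), outState_eq h, smul_smul,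
    inner_smul_left, inner_smul_right, inner_geo_geo hz1 hz2, hu, hroot]
  have hphase : exp (-I * θ) * ampl θ √(lam ^ 2 - θ ^ 2) 1 =
      √(lam ^ 2 - θ ^ 2) / denom θ √(lam ^ 2 - θ ^ 2) 1 := by
    have : exp (-I * θ) * exp (I * θ * (1 : ℝ)) = 1 := by
      rw [← exp_add]; simp
    rw [ampl, mul_div_assoc', mul_left_comm, this, mul_one]
  rw [hphase, ratio]
  simp only [map_div₀, map_mul, map_neg, conj_I, conj_ofReal]
  have hD : starRingEnd ℂ (denom θ √(lam ^ 2 - θ ^ 2) 1) ≠ 0 :=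
    (map_ne_zero _).2 (denom_ne_zero hmu 1)
  have hconj := conj_denom θ √(lam ^ 2 - θ ^ 2) 1
  have hcs := Real.cosh_sq √(lam ^ 2 - θ ^ 2)
  have hc := Real.cosh_pos √(lam ^ 2 - θ ^ 2)
  simp only [mul_one] at hconj ⊢
  generalize starRingEnd ℂ (denom θ √(lam ^ 2 - θ ^ 2) 1) = D at *
  generalize √(lam ^ 2 - θ ^ 2) = mu at *
  generalize Real.cosh mu = c at *
  generalize Real.sinh mu = s at *
  have hc' : (c : ℂ) ≠ 0 := by exact_mod_cast hc.ne'
  have hl' : (lam : ℂ) ≠ 0 := by exact_mod_cast hlam.ne'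
  have hcs' : (c : ℂ) ^ 2 = s ^ 2 + 1 := by exact_mod_cast hcs
  have key : 1 - - -I * (lam : ℂ) * s / D * (-(((θ / lam : ℝ) : ℂ) + I * ((mu / lam : ℝ) : ℂ)) *
      (s / c)) = (mu - I * (θ * ((s * (c - s) : ℝ) : ℂ))) / (D * c) := by
    push_cast
    field_simp
    rw [hconj]
    linear_combination mu * hcs' + mu * s ^ 2 * I_sq
  rw [key, inv_div]
  field_simp

theorem norm_squeezedVac {f : ℝ} (hf : 0 < f) {u : ℂ} (hu : ‖u‖ = 1) :
    ‖squeezedVac (f * u)‖ = 1 := by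
  have := norm_ampl_smul_geo (θ := 0) (mu := f) (w := I * (f * u)) hf (by simp [hu]) 1
  rwa [← unitaryExp_quadGen_vac hf (by simp [hu]), ← squeezeGen_eq] at this

theorem norm_outState {lam θ : ℝ} (h : θ ^ 2 < lam ^ 2) : ‖outState lam θ‖ = 1 := by
  rw [outState_eq h]
  exact norm_ampl_smul_geo (sqrt_sub_sq_pos h)
    (by rw [sq_sqrt_sub_sq h, norm_real, Real.norm_eq_abs, sq_abs]) 1

theorem norm_outState_sub_squeezedVac_le {lam θ : ℝ} (hlam : 0 < lam) (h : θ ^ 2 < lam ^ 2) :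
    ‖exp (-I * θ) • outState lam θ - squeezedVac (√(lam ^ 2 - θ ^ 2) *
        exp (I * (Real.pi + Real.arccos (θ / lam))))‖ ≤ √(2 * θ ^ 2 / (lam ^ 2 - θ ^ 2)) := by
  have hmu := sqrt_sub_sq_pos h
  refine Real.le_sqrt_of_sq_le ?_
  have hu : ‖exp (I * (Real.pi + Real.arccos (θ / lam)))‖ = 1 := by
    rw [← ofReal_add]; exact norm_exp_I_mul_ofReal _
  have h1 : ‖exp (-I * θ) • outState lam θ‖ = 1 := by
    rw [norm_smul, norm_outState h, mul_one, neg_mul_comm, ← ofReal_neg]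
    exact norm_exp_I_mul_ofReal _
  rw [@norm_sub_sq ℂ, h1, norm_squeezedVac hmu hu, inner_outState_squeezedVac hlam h]
  have hm := sq_sqrt_sub_sq h
  have hs := Real.sinh_pos_iff.2 hmu
  have hcs := Real.cosh_sq √(lam ^ 2 - θ ^ 2)
  have hlt := Real.sinh_lt_cosh √(lam ^ 2 - θ ^ 2)
  generalize √(lam ^ 2 - θ ^ 2) = mu at *
  generalize Real.cosh mu = c at *
  generalize Real.sinh mu = s at *
  have hq0 : 0 ≤ s * (c - s) := mul_nonneg hs.le (by linarith)
  -- From `(c - s)(c + s) = 1` and `s ≤ c + s`; hence the overlap differs from 1 only through `θq /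
  -- μ` with bounded `q`.
  have hq1 : s * (c - s) ≤ 1 := by nlinarith
  generalize s * (c - s) = q at *
  have hre : RCLike.re ((mu : ℂ) / (mu - I * (θ * (q : ℂ)))) = mu ^ 2 / (mu ^ 2 + (θ * q) ^ 2) := by
    rw [RCLike.re_eq_complex_re, div_re, normSq_apply]
    simp
    ring
  rw [hre, ← hm]
  have hpos : 0 < mu ^ 2 + (θ * q) ^ 2 := by positivity
  have e : 1 ^ 2 - 2 * (mu ^ 2 / (mu ^ 2 + (θ * q) ^ 2)) + 1 ^ 2 =
      2 * (θ * q) ^ 2 / (mu ^ 2 + (θ * q) ^ 2) := by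
    field_simp
    ring
  rw [e]
  have hq2 : q ^ 2 ≤ 1 := pow_le_one₀ hq0 hq1
  refine div_le_div₀ (by positivity) ?_ (by positivity) (by nlinarith [sq_nonneg (θ * q)])
  rw [mul_pow]
  nlinarith [sq_nonneg θ]

theorem tendsto_outState_sub_squeezedVac (θ : ℝ) :
    Tendsto (fun lam : ℝ => exp (-I * θ) • outState lam θ - squeezedVac (√(lam ^ 2 - θ ^ 2) *
      exp (I * (Real.pi + Real.arccos (θ / lam))))) atTop (𝓝 0) := by
  have hlim : Tendsto (fun lam : ℝ => √(2 * θ ^ 2 / (lam ^ 2 - θ ^ 2))) atTop (𝓝 0) := by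
    rw [← Real.sqrt_zero]
    refine (Real.continuous_sqrt.tendsto 0).comp (tendsto_const_nhds.div_atTop ?_)
    exact tendsto_atTop_add_const_right _ _ (tendsto_pow_atTop two_ne_zero)
  refine squeeze_zero_norm' ?_ hlim
  filter_upwards [eventually_gt_atTop |θ|] with lam hlam
  exact norm_outState_sub_squeezedVac_le ((abs_nonneg θ).trans_lt hlam)
    (sq_lt_sq' (by linarith [neg_abs_le θ]) ((le_abs_self θ).trans_lt hlam))

end TwoMode

theorem lemma1 (θ : ℝ) :
    (∀ ζ : ℂ, ∃! U, TwoMode.IsUnitaryGroup (TwoMode.squeezeGen ζ) U) ∧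
    (∀ lam : ℝ, 0 < lam → θ ^ 2 < lam ^ 2 →
      (∃! U, TwoMode.IsUnitaryGroup
        ((-Complex.I) • TwoMode.hamiltonian (lam / 2) θ Real.pi) U) ∧
      TwoMode.outState lam θ =
        (Complex.I * Complex.exp (Complex.I * (θ + TwoMode.sqXi lam θ))) •
          TwoMode.squeezedVac
            (TwoMode.sqF lam θ * Complex.exp (Complex.I * TwoMode.sqXi lam θ))) ∧
    Tendsto
      (fun lam : ℝ =>
        Complex.exp (-Complex.I * θ) • TwoMode.outState lam θ -
          TwoMode.squeezedVac
            (√(lam ^ 2 - θ ^ 2) *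
              Complex.exp (Complex.I * (Real.pi + Real.arccos (θ / lam)))))
      atTop (𝓝 0) := by
  refine ⟨fun ζ => ?_, fun lam hlam h => ⟨?_, TwoMode.outState_eq_squeezedVac hlam h⟩,
    TwoMode.tendsto_outState_sub_squeezedVac θ⟩
  · rw [TwoMode.squeezeGen_eq]
    exact TwoMode.existsUnique_quadGen _ _
  · rw [TwoMode.hamiltonian_eq]
    exact TwoMode.existsUnique_quadGen _ _
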